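/- Let $k = 2\kappa+1$ be an odd natural number. A random $k$-XOR instance $\Phi$ on $n$ variables with parameter $p\in[0,1]$ is sampled as follows: independently for each ordered scope $S\in[n]^k$, with probability $p$ add the constraint $\prod_{j=1}^k x_{S_j}=\eta_S$ with $\eta_S$ uniform in $\{\pm1\}$, and with probability $1-p$ add no constraint. (So $\Phi$ has $pn^k$ clauses in expectation.) Let $\mathbf T$ be the order-$k$ tensor with $\mathbf T_S=\eta_S$ if there is a constraint on $S$ and $\mathbf T_S=0$ otherwise, and for $i\in[n]$ let $T_i$ be the $n^\kappa\times n^\kappa$ matrix $T_i(I,K)=\mathbf T_{(I,K,i)}$, $I,K\in[n]^\kappa$. Let $\mathrm{squares}(T_i\otimes T_i)$ be the restriction of $T_i\otimes T_i$ to those entries in row $(I,J)$ and column $(K,L)$ for which $(I,K)=(J,L)$. Call a tuple of elements of $[n]$ low-multiplicity if no element of $[n]$ occurs in it more than $100\log n$ times ($\log$ is the natural logarithm). For $d\ge 1$ form the $n^{2d\kappa}\times n^{2d\kappa}$ matrix $$\Gamma=\sum_{U\in[n]^d\ \text{low-multiplicity}}\ \bigotimes_{j=1}^d\bigl(T_{U_j}\otimes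 T_{U_j}-\mathrm{squares}(T_{U_j}\otimes T_{U_j})\bigr),$$ and let $\Gamma_{(d)}$ be obtained from $\mathbb E_{\Pi,\Sigma}[\Pi\Gamma\Sigma]$, where $\Pi,\Sigma$ are independent and uniform over the permutation matrices that permute the $2d\kappa$ positions of the index tuples in $[n]^{2d\kappa}$, by setting to zero all rows and columns whose index tuple is not low-multiplicity. Let $\|\cdot\|$ be the spectral (operator) norm. Then there are constants $c_k>0$ and $a_k\in\mathbb N$ depending only on $k$ such that the following holds. Let $d=d(n)\in\mathbb N$ and $p=p(n)\in[0,1]$ be such that $d\log n/n\to0$ as $n\to\infty$ and $d^{(k-2)/2}n^{k/2}p>1$ for all sufficiently large $n$. Then with high probability over $\Phi$, $$\|\Gamma_{(d)}\|^{1/d}\ \le\ c_k(\log n)^{a_k}\cdot\frac{p\,n^{k/2}}{d^{(k-2)/2}};$$ that is, for every $A\in\mathbb N$ this inequality holds with probability at least $1-n^{-A}$ for all sufficiently large $n$. -/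

import Mathlib

open Filter Topology MeasureTheory
open scoped ENNReal Kronecker

noncomputable section

/-- A `k`-XOR instance on `n` variables. For every ordered scope `S ∈ [n]^k`, either there is no
constraint on `S` (`none`), or there is the constraint `∏ i, x (S i) = η` (`some η`), where
`η ∈ {1, -1}` and `x` ranges over `{1, -1}^n`. -/
abbrev XorInstance (n k : ℕ) : Type := (Fin k → Fin n) → Option ℤˣ

instance instMeasurableSpaceXorConstraint : MeasurableSpace (Option ℤˣ) := ⊤

/-- The law of the constraint on one scope: with probability `p` there is a constraint, with a
uniformly random sign, and with probability `1 - p` there is none. -/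
def xorConstraintLaw (p : ℝ) : Measure (Option ℤˣ) :=
  ENNReal.ofReal (1 - p) • Measure.dirac none +
    ENNReal.ofReal p •
      ((2⁻¹ : ℝ≥0∞) • Measure.dirac (some 1) + (2⁻¹ : ℝ≥0∞) • Measure.dirac (some (-1)))

/-- The law of a random `k`-XOR instance on `n` variables: the constraints on the `n ^ k` ordered
scopes are sampled independently. -/
def randomXor (n k : ℕ) (p : ℝ) : Measure (XorInstance n k) :=
  Measure.pi fun _ => xorConstraintLaw p

theorem isProbabilityMeasure_xorConstraintLaw {p : ℝ} (hp : p ∈ Set.Icc (0 : ℝ) 1) :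
    IsProbabilityMeasure (xorConstraintLaw p) := by
  constructor
  simp only [xorConstraintLaw, Measure.add_apply, Measure.smul_apply, measure_univ, smul_eq_mul,
    mul_one, ENNReal.inv_two_add_inv_two]
  rw [← ENNReal.ofReal_add (by linarith [hp.2]) hp.1]
  simp

theorem isProbabilityMeasure_randomXor (n k : ℕ) {p : ℝ} (hp : p ∈ Set.Icc (0 : ℝ) 1) :
    IsProbabilityMeasure (randomXor n k p) := by
  have := isProbabilityMeasure_xorConstraintLaw hp
  unfold randomXor
  infer_instance

/-- The order-`k` tensor of an instance: the entry at `S` is the sign of the constraint on `S`, and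
`0` if there is no constraint on `S`. -/
def xorTensor {n k : ℕ} (Φ : XorInstance n k) (S : Fin k → Fin n) : ℝ :=
  match Φ S with
  | none => 0
  | some η => ((η : ℤ) : ℝ)

/-- For `k = 2κ + 1`, the `n^κ × n^κ` slice `T_i` of the tensor of `Φ`. Its entry at `(I, K)` is the
tensor entry at the scope `(I, K, i)`. -/
def xorSlice {n k κ : ℕ} (hk : k = 2 * κ + 1) (Φ : XorInstance n k) (i : Fin n) :
    Matrix (Fin κ → Fin n) (Fin κ → Fin n) ℝ :=
  Matrix.of fun I K =>
    xorTensor Φ fun t =>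
      (Fin.snoc (Fin.append I K) i : Fin (κ + κ + 1) → Fin n) (Fin.cast (by omega) t)

/-- The restriction of a matrix to the entries in row `(I, J)` and column `(K, L)` with
`(I, K) = (J, L)`. -/
def squaresPart {α : Type*} [DecidableEq α] (M : Matrix (α × α) (α × α) ℝ) :
    Matrix (α × α) (α × α) ℝ :=
  Matrix.of fun r c => if (r.1, c.1) = (r.2, c.2) then M r c else 0

/-- `T_i ⊗ T_i - squares(T_i ⊗ T_i)`. -/
def squaredSlice {n k κ : ℕ} (hk : k = 2 * κ + 1) (Φ : XorInstance n k) (i : Fin n) :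
    Matrix ((Fin κ → Fin n) × (Fin κ → Fin n)) ((Fin κ → Fin n) × (Fin κ → Fin n)) ℝ :=
  (xorSlice hk Φ i ⊗ₖ xorSlice hk Φ i) - squaresPart (xorSlice hk Φ i ⊗ₖ xorSlice hk Φ i)

/-- No element of `[n]` occurs in the tuple `S` with multiplicity greater than `100 log n`. -/
def LowMultiplicity {ι : Type*} [Fintype ι] {n : ℕ} (S : ι → Fin n) : Prop :=
  ∀ v : Fin n, ((Finset.univ.filter fun j => S j = v).card : ℝ) ≤ 100 * Real.log n

/-- The `2dκ` positions of an index tuple: `d` blocks, each made of two halves of length `κ`. -/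
abbrev IndexPos (d κ : ℕ) : Type := Fin d × Fin 2 × Fin κ

/-- The `j`-th block `(I_j, J_j)` of an index tuple in `[n]^{2dκ}`. -/
def indexBlock {n d κ : ℕ} (S : IndexPos d κ → Fin n) (j : Fin d) :
    (Fin κ → Fin n) × (Fin κ → Fin n) :=
  (fun t => S (j, 0, t), fun t => S (j, 1, t))

open scoped Classical in
/-- The sum over all `U ∈ [n]^d` of low multiplicity of the Kronecker products
`⨂ j, (T_{U j} ⊗ T_{U j} - squares(T_{U j} ⊗ T_{U j}))`. -/
def slicePowerSum {n k κ : ℕ} (hk : k = 2 * κ + 1) (d : ℕ) (Φ : XorInstance n k) :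
    Matrix (IndexPos d κ → Fin n) (IndexPos d κ → Fin n) ℝ :=
  Matrix.of fun S S' =>
    ∑ U : Fin d → Fin n, if LowMultiplicity U then
      ∏ j : Fin d, squaredSlice hk Φ (U j) (indexBlock S j) (indexBlock S' j) else 0

/-- The average of `Π Γ Σ` over all pairs of permutation matrices `Π`, `Σ` that permute the
positions of the row and of the column index tuples. -/
def symmetrizeIndices {ι α : Type*} [Fintype ι] [DecidableEq ι]
    (Γ : Matrix (ι → α) (ι → α) ℝ) : Matrix (ι → α) (ι → α) ℝ :=
  ((Fintype.card (Equiv.Perm ι) : ℝ) ^ 2)⁻¹ •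
    ∑ π : Equiv.Perm ι, ∑ σ : Equiv.Perm ι, Γ.submatrix (fun S => S ∘ π) (fun S => S ∘ σ)

open scoped Classical in
/-- The odd `k`-XOR certificate matrix `Γ_(d)`: the symmetrization of `slicePowerSum`, with all rows
and columns whose index tuple is not of low multiplicity set to zero. -/
def oddCertificate {n k κ : ℕ} (hk : k = 2 * κ + 1) (d : ℕ) (Φ : XorInstance n k) :
    Matrix (IndexPos d κ → Fin n) (IndexPos d κ → Fin n) ℝ :=
  Matrix.of fun S S' =>
    if LowMultiplicity S ∧ LowMultiplicity S' then
      symmetrizeIndices (slicePowerSum hk d Φ) S S' else 0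

/-- The operator norm of a real square matrix with respect to the Euclidean norm. -/
def euclideanOpNorm {m : Type*} [Fintype m] [DecidableEq m] (A : Matrix m m ℝ) : ℝ :=
  ‖Matrix.toEuclideanCLM (n := m) (𝕜 := ℝ) A‖

end

/-! The proof is the trace method. For the certificate `M`, `‖M‖ ^ (2r)` is at most the trace of `(M
* Mᵀ) ^ r`; with `r` of order `log n`, the dimension `n ^ (2dκ)` costs only a logarithmic factor
after taking roots.

The trace expands into products of `4dr` tensor entries. Such a product has mean zero if some scope
occurs exactly once; hence only products with at most `2dr` distinct scopes matter, with mean at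
most `p ^ #scopes`. Write `p = x * y` with `y = n ^ (-k/2) * d ^ (-(k-2)/2)`. The density assumption
gives `x ≥ 1`, so the mean is at most `x ^ (2dr) * y ^ #scopes`.

The weights `y ^ #scopes` are summed one matrix factor at a time (`MomentBound.mul`, `sum_step_le`).
Given the scopes `H` used so far and the row tuple, each block brings two distinct scopes with a
common last entry, and each is either new, at cost `y`, or already in `H` (`sum_block_le`). Low
multiplicity of the row tuple limits the positions where a known row half can be read off; low
multiplicity of `U` limits the old scopes with a given last entry. With `q = 2dκ` positions, the
average over row permutations gains about `q ^ (2κ)` per block (`avg_perm_le`), leaving `d ^ (1 -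
2κ)` up to logarithms (`stepBound_le`). Markov's inequality concludes. -/

section Counting

/-! ### Counting block choices by new and old scopes. -/

variable {V P Sc : Type*} [DecidableEq V] [Fintype P] {κ : ℕ}

/-- If every value of `S` has at most `lam` preimages, then every tuple of `κ` values has at most
`lam ^ κ` preimages. -/
theorem card_comp_eq_le {S : P → V} {lam : ℝ}
    (hS : ∀ v, ((Finset.univ.filter fun q => S q = v).card : ℝ) ≤ lam) (I : Fin κ → V) :
    ((Finset.univ.filter fun f : Fin κ → P => S ∘ f = I).card : ℝ) ≤ lam ^ κ := by
  classical
  have h : (Finset.univ.filter fun f : Fin κ → P => S ∘ f = I) =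
      Fintype.piFinset fun t => Finset.univ.filter fun q => S q = I t := by
    ext f
    simp [funext_iff]
  rw [h, Fintype.card_piFinset, Nat.cast_prod]
  calc _ ≤ ∏ _t : Fin κ, lam := Finset.prod_le_prod (fun _ _ => by positivity) fun t _ => hS (I t)
    _ = lam ^ κ := by simp

variable [Fintype V] [DecidableEq Sc]

/-- The number of pairs `(f, c)` for which the scope with the rows read off from `S` along `f`, the
columns `c` and the last entry `u` belongs to `H`. -/
def hitCount (e : (Fin κ → V) → (Fin κ → V) → V → Sc) (S : P → V) (H : Finset Sc) (u : V) : ℝ :=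
  ∑ f : Fin κ → P, ∑ c : Fin κ → V, if e (S ∘ f) c u ∈ H then (1 : ℝ) else 0

theorem hitCount_nonneg (e : (Fin κ → V) → (Fin κ → V) → V → Sc) (S : P → V) (H : Finset Sc)
    (u : V) : 0 ≤ hitCount e S H u :=
  Finset.sum_nonneg fun _ _ => Finset.sum_nonneg fun _ _ => by split_ifs <;> norm_num

/-- By injectivity, a scope in `H` with last entry `u` determines both of its halves. Only the
positions producing the row half remain free, and there are at most `lam ^ κ` choices of them. -/
theorem hitCount_le {e : (Fin κ → V) → (Fin κ → V) → V → Sc} {last : Sc → V}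
    (hlast : ∀ I K u, last (e I K u) = u)
    (hinj : ∀ u, Function.Injective fun q : (Fin κ → V) × (Fin κ → V) => e q.1 q.2 u)
    {S : P → V} {lam : ℝ} (hlam : 0 ≤ lam)
    (hS : ∀ v, ((Finset.univ.filter fun q => S q = v).card : ℝ) ≤ lam) (H : Finset Sc) (u : V) :
    hitCount e S H u ≤ lam ^ κ * (H.filter fun s => last s = u).card := by
  classical
  have h1 : hitCount e S H u = ∑ I : Fin κ → V,
      ((Finset.univ.filter fun f : Fin κ → P => S ∘ f = I).card : ℝ) *
        ∑ c : Fin κ → V, if e I c u ∈ H then (1 : ℝ) else 0 := by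
    unfold hitCount
    rw [← Finset.sum_fiberwise (s := Finset.univ) (g := fun f : Fin κ → P => S ∘ f)]
    refine Finset.sum_congr rfl fun I _ => ?_
    rw [← nsmul_eq_mul, ← Finset.sum_const]
    refine Finset.sum_congr rfl fun f hf => ?_
    rw [(Finset.mem_filter.1 hf).2]
  rw [h1]
  calc _ ≤ ∑ I : Fin κ → V, lam ^ κ * ∑ c : Fin κ → V, if e I c u ∈ H then (1 : ℝ) else 0 := by
        refine Finset.sum_le_sum fun I _ => mul_le_mul_of_nonneg_right (card_comp_eq_le hS I) ?_
        exact Finset.sum_nonneg fun _ _ => by split_ifs <;> norm_num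
    _ = lam ^ κ * ((Finset.univ.filter fun q : (Fin κ → V) × (Fin κ → V) =>
          e q.1 q.2 u ∈ H).card : ℝ) := by
        rw [← Finset.mul_sum, ← Fintype.sum_prod_type', Finset.sum_boole]
    _ ≤ _ := by
        gcongr
        refine Finset.card_le_card_of_injOn (fun q => e q.1 q.2 u) ?_ ((hinj u).injOn)
        intro q hq
        simpa [hlast] using hq

/-- The two scopes of a block with rows `r`, columns `c` and common last entry `u`. -/
def blockScopes (e : (Fin κ → V) → (Fin κ → V) → V → Sc) (r c : (Fin κ → V) × (Fin κ → V))
    (u : V) : Finset Sc :=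
  {e r.1 c.1 u, e r.2 c.2 u}

/-- The three summands account for two, one or no scopes in `H`. Being nonnegative, they can be
added instead of distinguished, which lets the later sums factor. -/
theorem pow_card_union_pair_le {y : ℝ} (hy : 0 ≤ y) (H : Finset Sc) {a b : Sc} (hab : a ≠ b) :
    y ^ (H ∪ {a, b}).card ≤ y ^ H.card *
      ((if a ∈ H then 1 else 0) * (if b ∈ H then 1 else 0) +
        y * ((if a ∈ H then 1 else 0) + (if b ∈ H then 1 else 0)) + y ^ 2) := by
  have h : H ∪ {a, b} = insert a (insert b H) := by
    ext s; simp only [Finset.mem_union, Finset.mem_insert, Finset.mem_singleton]; tauto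
  have hH : 0 ≤ y ^ H.card := by positivity
  rw [h]
  by_cases ha : a ∈ H <;> by_cases hb : b ∈ H <;> simp [ha, hb, hab, pow_succ] <;>
    nlinarith [mul_nonneg hH hy, mul_nonneg (mul_nonneg hH hy) hy]

/-- The choices for one block: where the two halves of the row are read off, the last entry, and
the column. -/
abbrev BlockChoice (V P : Type*) (κ : ℕ) : Type _ :=
  ((Fin κ → P) × (Fin κ → P)) × V × ((Fin κ → V) × (Fin κ → V))

/-- The two scopes of a block choice, its row being read off from `S`. -/
def choiceScopes (e : (Fin κ → V) → (Fin κ → V) → V → Sc) (S : P → V) (x : BlockChoice V P κ) :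
    Finset Sc :=
  blockScopes e (S ∘ x.1.1, S ∘ x.1.2) x.2.2 x.2.1

/-- The bound for the weight of one block. -/
def blockBound (q n κ : ℕ) (y lam h m : ℝ) : ℝ :=
  (q : ℝ) ^ (2 * κ) * (n : ℝ) ^ (2 * κ + 1) * y ^ 2 +
    2 * y * h * (q : ℝ) ^ κ * lam ^ κ * (n : ℝ) ^ κ + h * m * lam ^ (2 * κ)

theorem sum_block_le {e : (Fin κ → V) → (Fin κ → V) → V → Sc} {last : Sc → V}
    (hlast : ∀ I K u, last (e I K u) = u)
    (hinj : ∀ u, Function.Injective fun q : (Fin κ → V) × (Fin κ → V) => e q.1 q.2 u)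
    {S : P → V} {lam : ℝ} (hlam : 0 ≤ lam)
    (hS : ∀ v, ((Finset.univ.filter fun q => S q = v).card : ℝ) ≤ lam)
    {y h m : ℝ} (hy : 0 ≤ y) (hm : 0 ≤ m) {H : Finset Sc} (hH : (H.card : ℝ) ≤ h)
    (hfib : ∀ u, ((H.filter fun s => last s = u).card : ℝ) ≤ m) :
    ∑ x : BlockChoice V P κ,
        (if (choiceScopes e S x).card = 2 then y ^ (H ∪ choiceScopes e S x).card else 0) ≤
      y ^ H.card * blockBound (Fintype.card P) (Fintype.card V) κ y lam h m := by
  classical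
  have hle : ∀ u, hitCount e S H u ≤ lam ^ κ * (H.filter fun s => last s = u).card :=
    hitCount_le hlast hinj hlam hS H
  have hsum : ∑ u, ((H.filter fun s => last s = u).card : ℝ) = H.card := by
    rw [← Nat.cast_sum, Finset.card_eq_sum_card_fiberwise (f := last) (t := Finset.univ)]
    simp
  -- One old scope: the last entry is free, so only the size of `H` counts.
  have hA : ∑ u, hitCount e S H u ≤ lam ^ κ * h := by
    calc _ ≤ ∑ u, lam ^ κ * ((H.filter fun s => last s = u).card : ℝ) :=
          Finset.sum_le_sum fun u _ => hle u
      _ = lam ^ κ * H.card := by rw [← Finset.mul_sum, hsum]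
      _ ≤ _ := by gcongr
  -- Two old scopes share their last entry `u`: the first ranges over `H`, the second over a single
  -- fibre of size at most `m`.
  have hB : ∑ u, hitCount e S H u ^ 2 ≤ h * m * lam ^ (2 * κ) := by
    calc _ ≤ ∑ u, (lam ^ κ * m) * (lam ^ κ * ((H.filter fun s => last s = u).card : ℝ)) := by
          refine Finset.sum_le_sum fun u _ => ?_
          rw [pow_two]
          refine mul_le_mul ((hle u).trans ?_) (hle u) (hitCount_nonneg _ _ _ _) (by positivity)
          gcongr
          exact hfib u
      _ = lam ^ (2 * κ) * m * H.card := by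
          rw [← Finset.mul_sum, ← Finset.mul_sum, hsum]; ring
      _ ≤ lam ^ (2 * κ) * m * h := by gcongr
      _ = _ := by ring
  set ind : Sc → ℝ := fun s => if s ∈ H then 1 else 0 with hind
  have hpt : ∀ x : BlockChoice V P κ,
      (if (choiceScopes e S x).card = 2 then y ^ (H ∪ choiceScopes e S x).card else 0) ≤
      y ^ H.card *
        (ind (e (S ∘ x.1.1) x.2.2.1 x.2.1) * ind (e (S ∘ x.1.2) x.2.2.2 x.2.1) +
          y * (ind (e (S ∘ x.1.1) x.2.2.1 x.2.1) + ind (e (S ∘ x.1.2) x.2.2.2 x.2.1)) + y ^ 2) := by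
    intro x
    split_ifs with hc
    · refine pow_card_union_pair_le hy H fun hab => ?_
      rw [choiceScopes, blockScopes, hab] at hc
      simp at hc
    · have : ∀ s, 0 ≤ ind s := fun s => by simp only [hind]; split_ifs <;> norm_num
      have h1 := this (e (S ∘ x.1.1) x.2.2.1 x.2.1)
      have h2 := this (e (S ∘ x.1.2) x.2.2.2 x.2.1)
      positivity
  refine (Finset.sum_le_sum fun x _ => hpt x).trans ?_
  rw [← Finset.mul_sum]
  refine mul_le_mul_of_nonneg_left ?_ (by positivity)
  have hS1 : ∑ x : BlockChoice V P κ,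
      ind (e (S ∘ x.1.1) x.2.2.1 x.2.1) * ind (e (S ∘ x.1.2) x.2.2.2 x.2.1) =
      ∑ u, hitCount e S H u ^ 2 := by
    simp only [Fintype.sum_prod_type, hitCount, pow_two]
    rw [Finset.sum_congr rfl fun a _ => Finset.sum_comm, Finset.sum_comm]
    refine Finset.sum_congr rfl fun u _ => ?_
    rw [Finset.sum_mul_sum]
    refine Finset.sum_congr rfl fun f _ => Finset.sum_congr rfl fun g _ => ?_
    rw [Finset.sum_mul_sum]
  have hS2 : ∑ x : BlockChoice V P κ, ind (e (S ∘ x.1.1) x.2.2.1 x.2.1) =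
      (Fintype.card P : ℝ) ^ κ * (Fintype.card V : ℝ) ^ κ * ∑ u, hitCount e S H u := by
    simp only [Fintype.sum_prod_type, hitCount]
    simp only [Finset.sum_const, Finset.card_univ, nsmul_eq_mul, Fintype.card_pi, Finset.prod_const,
      Nat.cast_pow, Fintype.card_fin, ← Finset.mul_sum]
    rw [Finset.sum_comm]
    ring
  have hS3 : ∑ x : BlockChoice V P κ, ind (e (S ∘ x.1.2) x.2.2.2 x.2.1) =
      (Fintype.card P : ℝ) ^ κ * (Fintype.card V : ℝ) ^ κ * ∑ u, hitCount e S H u := by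
    simp only [Fintype.sum_prod_type, hitCount]
    simp only [Finset.sum_const, Finset.card_univ, nsmul_eq_mul, Fintype.card_pi, Finset.prod_const,
      Nat.cast_pow, Fintype.card_fin, ← Finset.mul_sum]
    rw [Finset.sum_comm]
    ring
  have hS4 : ∑ _x : BlockChoice V P κ, y ^ 2 =
      (Fintype.card P : ℝ) ^ (2 * κ) * (Fintype.card V : ℝ) ^ (2 * κ + 1) * y ^ 2 := by
    simp only [Finset.sum_const, Finset.card_univ, nsmul_eq_mul, Fintype.card_prod,
      Fintype.card_pi, Finset.prod_const, Fintype.card_fin]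
    push_cast
    ring
  rw [Finset.sum_add_distrib, Finset.sum_add_distrib, ← Finset.mul_sum, Finset.sum_add_distrib,
    hS1, hS2, hS3, hS4, blockBound]
  have : y * ((Fintype.card P : ℝ) ^ κ * (Fintype.card V : ℝ) ^ κ * ∑ u, hitCount e S H u) ≤
      y * ((Fintype.card P : ℝ) ^ κ * (Fintype.card V : ℝ) ^ κ * (lam ^ κ * h)) := by gcongr
  linarith

/-- The scopes of a sequence of block choices, added to `H`. -/
def addScopes (e : (Fin κ → V) → (Fin κ → V) → V → Sc) (S : P → V) (H : Finset Sc) {j : ℕ}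
    (x : Fin j → BlockChoice V P κ) : Finset Sc :=
  H ∪ Finset.univ.biUnion fun i => choiceScopes e S (x i)

theorem addScopes_cons (e : (Fin κ → V) → (Fin κ → V) → V → Sc) (S : P → V) (H : Finset Sc) {j : ℕ}
    (x₀ : BlockChoice V P κ) (x : Fin j → BlockChoice V P κ) :
    addScopes e S H (Fin.cons x₀ x : Fin (j + 1) → BlockChoice V P κ) =
      addScopes e S (H ∪ choiceScopes e S x₀) x := by
  ext s
  simp only [addScopes, Finset.mem_union, Finset.mem_biUnion, Finset.mem_univ, true_and,
    Fin.exists_fin_succ, Fin.cons_zero, Fin.cons_succ]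
  tauto

-- Blocks are peeled off from the front; each adds two scopes to `H`, whence the budget `2 * j`. The
-- fibre bound is imposed on the final set and passes to subsets, so either it holds for the current
-- `H` or the sum vanishes.
open scoped Classical in
theorem sum_blocks_le {e : (Fin κ → V) → (Fin κ → V) → V → Sc} {last : Sc → V}
    (hlast : ∀ I K u, last (e I K u) = u)
    (hinj : ∀ u, Function.Injective fun q : (Fin κ → V) × (Fin κ → V) => e q.1 q.2 u)
    {S : P → V} {lam : ℝ} (hlam : 0 ≤ lam)
    (hS : ∀ v, ((Finset.univ.filter fun q => S q = v).card : ℝ) ≤ lam)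
    {y h m : ℝ} (hy : 0 ≤ y) (hh : 0 ≤ h) (hm : 0 ≤ m) (j : ℕ) {H : Finset Sc}
    (hH : (H.card : ℝ) + 2 * j ≤ h) :
    ∑ x : Fin j → BlockChoice V P κ,
        (if (∀ u, (((addScopes e S H x).filter fun s => last s = u).card : ℝ) ≤ m) ∧
          ∀ i, (choiceScopes e S (x i)).card = 2 then y ^ (addScopes e S H x).card else 0) ≤
      y ^ H.card * blockBound (Fintype.card P) (Fintype.card V) κ y lam h m ^ j := by
  have hbb : 0 ≤ blockBound (Fintype.card P) (Fintype.card V) κ y lam h m := by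
    unfold blockBound; positivity
  induction j generalizing H with
  | zero =>
    simp only [Finset.univ_unique, Finset.sum_singleton, pow_zero, mul_one]
    split_ifs
    · simp [addScopes]
    · positivity
  | succ j ih =>
    push_cast at hH
    have hH0 : (H.card : ℝ) ≤ h := by have : (0 : ℝ) ≤ j := by positivity
                                      linarith
    by_cases hfib : ∀ u, ((H.filter fun s => last s = u).card : ℝ) ≤ m
    · rw [← (Fin.consEquiv fun _ => BlockChoice V P κ).sum_comp, Fintype.sum_prod_type]
      calc _ ≤ ∑ x₀ : BlockChoice V P κ, (if (choiceScopes e S x₀).card = 2 then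
              y ^ (H ∪ choiceScopes e S x₀).card else 0) *
              blockBound (Fintype.card P) (Fintype.card V) κ y lam h m ^ j := by
            refine Finset.sum_le_sum fun x₀ _ => ?_
            by_cases hc : (choiceScopes e S x₀).card = 2
            · rw [if_pos hc]
              refine le_trans (le_of_eq ?_) (ih (H := H ∪ choiceScopes e S x₀) ?_)
              · refine Finset.sum_congr rfl fun x _ => ?_
                simp only [Fin.consEquiv, Equiv.coe_fn_mk, addScopes_cons, Fin.forall_fin_succ,
                  Fin.cons_zero, Fin.cons_succ, hc, true_and]
              · have := Finset.card_union_le H (choiceScopes e S x₀)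
                rw [hc] at this
                have h2 : ((H ∪ choiceScopes e S x₀).card : ℝ) ≤ H.card + 2 := by exact_mod_cast this
                linarith
            · rw [if_neg hc, zero_mul]
              refine le_of_eq (Finset.sum_eq_zero fun x _ => if_neg fun hx => hc ?_)
              exact hx.2 0
        _ ≤ y ^ H.card * blockBound (Fintype.card P) (Fintype.card V) κ y lam h m *
              blockBound (Fintype.card P) (Fintype.card V) κ y lam h m ^ j := by
            rw [← Finset.sum_mul]
            exact mul_le_mul_of_nonneg_right (sum_block_le hlast hinj hlam hS hy hm hH0 hfib)
              (by positivity)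
        _ = _ := by ring
    · refine le_trans (le_of_eq (Finset.sum_eq_zero fun x _ => if_neg fun hx => hfib fun u => ?_))
        (by positivity)
      refine le_trans ?_ (hx.1 u)
      gcongr
      exact Finset.subset_union_left

/-- A tuple indexed by `d` blocks of two halves, as a family of `d` pairs of halves. -/
def blockEquiv (d κ : ℕ) (β : Type*) :
    (IndexPos d κ → β) ≃ (Fin d → (Fin κ → β) × (Fin κ → β)) where
  toFun f j := (fun t => f (j, 0, t), fun t => f (j, 1, t))
  invFun g q := if q.2.1 = 0 then (g q.1).1 q.2.2 else (g q.1).2 q.2.2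
  left_inv f := by
    ext ⟨j, b, t⟩
    fin_cases b <;> simp
  right_inv g := by ext j <;> simp

end Counting

/-! ### Averages over permutations. -/

/-- Replacing permutations by arbitrary self-maps in an average costs at most `exp (card ι)`. -/
theorem avg_perm_le {ι : Type*} [Fintype ι] [DecidableEq ι] (F : (ι → ι) → ℝ) (hF : ∀ f, 0 ≤ F f) :
    ((Fintype.card (Equiv.Perm ι) : ℝ))⁻¹ * ∑ π : Equiv.Perm ι, F π ≤
      Real.exp (Fintype.card ι) / (Fintype.card ι : ℝ) ^ Fintype.card ι * ∑ f : ι → ι, F f := by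
  have h1 : ∑ π : Equiv.Perm ι, F π ≤ ∑ f : ι → ι, F f := by
    rw [← Finset.sum_image (f := F) (g := fun π : Equiv.Perm ι => (π : ι → ι))
      (fun a _ b _ hab => Equiv.coe_fn_injective hab)]
    exact Finset.sum_le_sum_of_subset_of_nonneg (Finset.subset_univ _) fun f _ _ => hF f
  have h2 : (0 : ℝ) < (Fintype.card ι : ℝ) ^ Fintype.card ι := by
    rcases Nat.eq_zero_or_pos (Fintype.card ι) with h | h
    · simp [h]
    · positivity
  refine mul_le_mul ?_ h1 (Finset.sum_nonneg fun _ _ => hF _) (by positivity)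
  rw [Fintype.card_perm, inv_le_iff_one_le_mul₀ (by positivity), div_mul_eq_mul_div, le_div_iff₀ h2,
    one_mul]
  -- One term of the exponential series: `q ^ q / q! ≤ exp q`.
  have := Real.pow_div_factorial_le_exp (Fintype.card ι : ℝ) (by positivity) (Fintype.card ι)
  rwa [div_le_iff₀ (by positivity)] at this

/-! ### Moments of products of tensor entries. -/

section Moments

instance instDiscreteMeasurableSpaceXorConstraint : DiscreteMeasurableSpace (Option ℤˣ) :=
  ⟨fun _ => trivial⟩

/-- The tensor entry given by the constraint on one scope. -/
def constraintSign (o : Option ℤˣ) : ℝ :=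
  match o with
  | none => 0
  | some η => ((η : ℤ) : ℝ)

theorem xorTensor_eq {n k : ℕ} (Φ : XorInstance n k) (S : Fin k → Fin n) :
    xorTensor Φ S = constraintSign (Φ S) := rfl

theorem integral_constraintSign_pow {p : ℝ} (hp : p ∈ Set.Icc (0 : ℝ) 1) (c : ℕ) :
    ∫ o, constraintSign o ^ c ∂xorConstraintLaw p =
      (1 - p) * 0 ^ c + p * (2⁻¹ * 1 + 2⁻¹ * (-1) ^ c) := by
  have hi : ∀ ν : Measure (Option ℤˣ), IsFiniteMeasure ν →
      Integrable (fun o => constraintSign o ^ c) ν := fun ν _ => Integrable.of_finite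
  have h2 : ∀ o : Option ℤˣ, IsFiniteMeasure ((2⁻¹ : ℝ≥0∞) • Measure.dirac o) := fun o =>
    Measure.smul_finite _ (by simp)
  have := h2 (some 1)
  have := h2 (some (-1))
  have h3 : IsFiniteMeasure (ENNReal.ofReal p •
      ((2⁻¹ : ℝ≥0∞) • Measure.dirac (some (1 : ℤˣ)) + (2⁻¹ : ℝ≥0∞) • Measure.dirac (some (-1)))) :=
    Measure.smul_finite _ (by simp)
  have h4 : IsFiniteMeasure (ENNReal.ofReal (1 - p) • Measure.dirac (none : Option ℤˣ)) :=
    Measure.smul_finite _ (by simp)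
  rw [xorConstraintLaw, integral_add_measure (hi _ h4) (hi _ h3), integral_smul_measure,
    integral_smul_measure, integral_add_measure (hi _ (h2 _)) (hi _ (h2 _)), integral_smul_measure,
    integral_smul_measure, integral_dirac, integral_dirac, integral_dirac,
    ENNReal.toReal_ofReal hp.1, ENNReal.toReal_ofReal (by linarith [hp.2])]
  simp [constraintSign]

variable {n k : ℕ}

theorem integral_prod_xorTensor {p : ℝ} (hp : p ∈ Set.Icc (0 : ℝ) 1)
    (l : List (Fin k → Fin n)) :
    ∫ Φ, (l.map (xorTensor Φ)).prod ∂randomXor n k p =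
      ∏ s : Fin k → Fin n, ∫ o, constraintSign o ^ l.count s ∂xorConstraintLaw p := by
  have := isProbabilityMeasure_xorConstraintLaw hp
  rw [randomXor, ← integral_fintype_prod_eq_prod]
  congr 1
  ext Φ
  rw [Finset.prod_list_map_count]
  refine Finset.prod_subset (Finset.subset_univ _) fun s _ hs => ?_
  rw [List.mem_toFinset] at hs
  simp [List.count_eq_zero_of_not_mem hs]

/-- If fewer than two factors per distinct scope are available on average, some scope occurs exactly
once and its symmetric sign kills the mean. Otherwise each distinct scope contributes `p` or `0`. -/
theorem abs_integral_prod_xorTensor_le {p : ℝ} (hp : p ∈ Set.Icc (0 : ℝ) 1)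
    (l : List (Fin k → Fin n)) :
    |∫ Φ, (l.map (xorTensor Φ)).prod ∂randomXor n k p| ≤
      if 2 * l.toFinset.card ≤ l.length then p ^ l.toFinset.card else 0 := by
  rw [integral_prod_xorTensor hp]
  split_ifs with hl
  · rw [Finset.abs_prod, ← Finset.prod_subset (Finset.subset_univ l.toFinset)]
    · calc _ ≤ ∏ s ∈ l.toFinset, p := by
            refine Finset.prod_le_prod (fun _ _ => abs_nonneg _) fun s hs => ?_
            have hc : l.count s ≠ 0 := by
              rw [List.mem_toFinset] at hs
              exact (List.count_pos_iff.2 hs).ne'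
            rw [integral_constraintSign_pow hp, zero_pow hc]
            rcases Nat.even_or_odd (l.count s) with h | h
            · rw [h.neg_one_pow, abs_le]; constructor <;> linarith [hp.1]
            · rw [h.neg_one_pow, abs_le]; constructor <;> linarith [hp.1]
        _ = _ := by simp
    · intro s _ hs
      rw [List.mem_toFinset] at hs
      rw [integral_constraintSign_pow hp, List.count_eq_zero_of_not_mem hs]
      norm_num
  · obtain ⟨s, hs⟩ : ∃ s, l.count s = 1 := by
      by_contra! hne
      refine hl ?_
      rw [← List.sum_toFinset_count_eq_length l, mul_comm, ← smul_eq_mul]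
      refine Finset.card_nsmul_le_sum _ _ _ fun s hs => ?_
      rw [List.mem_toFinset] at hs
      have := List.count_pos_iff.2 hs
      have := hne s
      omega
    rw [Finset.prod_eq_zero (Finset.mem_univ s), abs_zero]
    rw [integral_constraintSign_pow hp, hs]
    norm_num

end Moments

/-! ### Weights of one matrix factor. -/

section Step

variable {n k κ d : ℕ}

/-- The product of the tensor entries over all scopes of the blocks with row tuple `R`, column tuple
`R'` and last entries `U`; it is `0` if the two scopes of a block coincide or if `U` is not of low
multiplicity. -/
noncomputable def blockMonomial (e : (Fin κ → Fin n) → (Fin κ → Fin n) → Fin n → (Fin k → Fin n))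
    (Φ : XorInstance n k) (R R' : IndexPos d κ → Fin n) (U : Fin d → Fin n) : ℝ :=
  open scoped Classical in
  if LowMultiplicity U ∧
      ∀ j, (blockScopes e (indexBlock R j) (indexBlock R' j) (U j)).card = 2 then
    ∏ j, xorTensor Φ (e (indexBlock R j).1 (indexBlock R' j).1 (U j)) *
      xorTensor Φ (e (indexBlock R j).2 (indexBlock R' j).2 (U j)) else 0

/-- All scopes of the blocks with row tuple `R`, column tuple `R'` and last entries `U`. -/
def blockList (e : (Fin κ → Fin n) → (Fin κ → Fin n) → Fin n → (Fin k → Fin n))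
    (R R' : IndexPos d κ → Fin n) (U : Fin d → Fin n) : List (Fin k → Fin n) :=
  List.ofFn (fun j => e (indexBlock R j).1 (indexBlock R' j).1 (U j)) ++
    List.ofFn (fun j => e (indexBlock R j).2 (indexBlock R' j).2 (U j))

theorem prod_blockList (e : (Fin κ → Fin n) → (Fin κ → Fin n) → Fin n → (Fin k → Fin n))
    (Φ : XorInstance n k) (R R' : IndexPos d κ → Fin n) (U : Fin d → Fin n) :
    ((blockList e R R' U).map (xorTensor Φ)).prod =
      ∏ j, xorTensor Φ (e (indexBlock R j).1 (indexBlock R' j).1 (U j)) *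
        xorTensor Φ (e (indexBlock R j).2 (indexBlock R' j).2 (U j)) := by
  simp [blockList, List.map_ofFn, List.prod_ofFn, Finset.prod_mul_distrib]

theorem length_blockList (e : (Fin κ → Fin n) → (Fin κ → Fin n) → Fin n → (Fin k → Fin n))
    (R R' : IndexPos d κ → Fin n) (U : Fin d → Fin n) :
    (blockList e R R' U).length = 2 * d := by
  simp [blockList]; ring

theorem toFinset_blockList (e : (Fin κ → Fin n) → (Fin κ → Fin n) → Fin n → (Fin k → Fin n))
    (R R' : IndexPos d κ → Fin n) (U : Fin d → Fin n) :
    (blockList e R R' U).toFinset =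
      Finset.univ.biUnion fun j => blockScopes e (indexBlock R j) (indexBlock R' j) (U j) := by
  ext s
  simp only [blockList, List.toFinset_append, Finset.mem_union, List.mem_toFinset, List.mem_ofFn,
    Finset.mem_biUnion, Finset.mem_univ, true_and, blockScopes, Finset.mem_insert,
    Finset.mem_singleton, exists_or, eq_comm]

theorem card_filter_blockList_le
    {e : (Fin κ → Fin n) → (Fin κ → Fin n) → Fin n → (Fin k → Fin n)}
    {last : (Fin k → Fin n) → Fin n} (hlast : ∀ I K u, last (e I K u) = u)
    (R R' : IndexPos d κ → Fin n) {U : Fin d → Fin n} (hU : LowMultiplicity U) (u : Fin n) :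
    (((blockList e R R' U).toFinset.filter fun s => last s = u).card : ℝ) ≤
      2 * (100 * Real.log n) := by
  have h1 : ((blockList e R R' U).toFinset.filter fun s => last s = u) ⊆
      (Finset.univ.filter fun j => U j = u).biUnion
        fun j => blockScopes e (indexBlock R j) (indexBlock R' j) (U j) := by
    intro s
    rw [toFinset_blockList]
    simp only [Finset.mem_filter, Finset.mem_biUnion, Finset.mem_univ, true_and]
    rintro ⟨⟨j, hj⟩, hs⟩
    refine ⟨j, ?_, hj⟩
    simp only [blockScopes, Finset.mem_insert, Finset.mem_singleton] at hj
    rcases hj with rfl | rfl <;> simpa [hlast] using hs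
  have h2 := (Finset.card_le_card h1).trans (Finset.card_biUnion_le_card_mul _ _ 2
    fun j _ => Finset.card_le_two)
  have h3 : (((blockList e R R' U).toFinset.filter fun s => last s = u).card : ℝ) ≤
      (Finset.univ.filter fun j => U j = u).card * 2 := by exact_mod_cast h2
  have := hU u
  linarith

open scoped Classical in
/-- The bound for one step: the weights `y ^ #scopes` of all row positions (permutations), columns
and last entries. -/
theorem sum_step_le
    {e : (Fin κ → Fin n) → (Fin κ → Fin n) → Fin n → (Fin k → Fin n)}
    {last : (Fin k → Fin n) → Fin n} (hlast : ∀ I K u, last (e I K u) = u)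
    (hinj : ∀ u, Function.Injective fun q : (Fin κ → Fin n) × (Fin κ → Fin n) => e q.1 q.2 u)
    {S : IndexPos d κ → Fin n} (hS : LowMultiplicity S) {y h m : ℝ} (hy : 0 ≤ y) (hh : 0 ≤ h)
    (hm : 0 ≤ m) {H : Finset (Fin k → Fin n)} (hH : (H.card : ℝ) + 2 * d ≤ h)
    (hfib : ∀ u, ((H.filter fun s => last s = u).card : ℝ) + 2 * (100 * Real.log n) ≤ m) :
    ((Fintype.card (Equiv.Perm (IndexPos d κ)) : ℝ) ^ 2)⁻¹ *
      ∑ S' : IndexPos d κ → Fin n, ∑ π : Equiv.Perm (IndexPos d κ),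
        ∑ σ : Equiv.Perm (IndexPos d κ), ∑ U : Fin d → Fin n,
        (if LowMultiplicity U ∧ ∀ j,
            (blockScopes e (indexBlock (S ∘ π) j) (indexBlock (S' ∘ σ) j) (U j)).card = 2 then
          y ^ (H ∪ (blockList e (S ∘ π) (S' ∘ σ) U).toFinset).card else 0) ≤
      y ^ H.card * (Real.exp (Fintype.card (IndexPos d κ)) /
        (Fintype.card (IndexPos d κ) : ℝ) ^ Fintype.card (IndexPos d κ) *
        blockBound (Fintype.card (IndexPos d κ)) n κ y (100 * Real.log n) h m ^ d) := by
  set q := Fintype.card (IndexPos d κ)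
  set Z : ℝ := (Fintype.card (Equiv.Perm (IndexPos d κ)) : ℝ) with hZ
  have hZ0 : 0 < Z := by rw [hZ]; positivity
  set term : (IndexPos d κ → Fin n) → (IndexPos d κ → Fin n) → (Fin d → Fin n) → ℝ :=
    fun R R' U => if LowMultiplicity U ∧ ∀ j,
            (blockScopes e (indexBlock R j) (indexBlock R' j) (U j)).card = 2 then
          y ^ (H ∪ (blockList e R R' U).toFinset).card else 0 with hterm
  have hterm0 : ∀ R R' U, 0 ≤ term R R' U := fun R R' U => by
    simp only [hterm]; split_ifs <;> positivity
  -- The sum over all `S'` absorbs the column permutation; the row permutation remains since `S` is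
  -- fixed.
  have hcol : ∀ (R : IndexPos d κ → Fin n) (σ : Equiv.Perm (IndexPos d κ)),
      ∑ S' : IndexPos d κ → Fin n, ∑ U, term R (S' ∘ σ) U = ∑ S', ∑ U, term R S' U := by
    intro R σ
    exact (σ.arrowCongr (Equiv.refl (Fin n))).symm.sum_comp fun S' => ∑ U, term R S' U
  have h1 : (Z ^ 2)⁻¹ * ∑ S' : IndexPos d κ → Fin n, ∑ π : Equiv.Perm (IndexPos d κ),
        ∑ σ : Equiv.Perm (IndexPos d κ), ∑ U : Fin d → Fin n, term (S ∘ π) (S' ∘ σ) U =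
      Z⁻¹ * ∑ π : Equiv.Perm (IndexPos d κ), ∑ S' : IndexPos d κ → Fin n,
        ∑ U : Fin d → Fin n, term (S ∘ π) S' U := by
    rw [Finset.sum_comm]
    have : ∀ π : Equiv.Perm (IndexPos d κ), ∑ S' : IndexPos d κ → Fin n,
        ∑ σ : Equiv.Perm (IndexPos d κ), ∑ U : Fin d → Fin n, term (S ∘ π) (S' ∘ σ) U =
        Z * ∑ S' : IndexPos d κ → Fin n, ∑ U : Fin d → Fin n, term (S ∘ π) S' U := by
      intro π
      rw [Finset.sum_comm, Finset.sum_congr rfl fun σ _ => hcol (S ∘ π) σ]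
      rw [Finset.sum_const, nsmul_eq_mul, hZ, Finset.card_univ]
    rw [Finset.sum_congr rfl fun π _ => this π, ← Finset.mul_sum]
    field_simp
  rw [h1]
  have hlam : 0 ≤ 100 * Real.log n := by have := Real.log_natCast_nonneg n; positivity
  have h2 := avg_perm_le (fun f : IndexPos d κ → IndexPos d κ =>
    ∑ S' : IndexPos d κ → Fin n, ∑ U : Fin d → Fin n, term (S ∘ f) S' U)
    (fun f => Finset.sum_nonneg fun _ _ => Finset.sum_nonneg fun _ _ => hterm0 _ _ _)
  refine h2.trans ?_
  have h3 : ∑ f : IndexPos d κ → IndexPos d κ, ∑ S' : IndexPos d κ → Fin n,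
      ∑ U : Fin d → Fin n, term (S ∘ f) S' U ≤
      y ^ H.card * blockBound q n κ y (100 * Real.log n) h m ^ d := by
    have h4 := sum_blocks_le hlast hinj (S := S) hlam (fun v => by convert hS v)
      hy hh hm d hH
    rw [Fintype.card_fin] at h4
    refine le_trans ?_ h4
    -- A self-map of the positions, last entries and a column tuple together amount to one
    -- `BlockChoice` for each of the `d` blocks.
    rw [← (Equiv.arrowProdEquivProdArrow (Fin d) _ _).symm.sum_comp, Fintype.sum_prod_type,
      ← (blockEquiv d κ (IndexPos d κ)).sum_comp]
    refine Finset.sum_le_sum fun f _ => ?_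
    rw [← (Equiv.arrowProdEquivProdArrow (Fin d) _ _).symm.sum_comp, Fintype.sum_prod_type,
      Finset.sum_comm]
    refine Finset.sum_le_sum fun U _ => ?_
    rw [← (blockEquiv d κ (Fin n)).sum_comp]
    refine Finset.sum_le_sum fun S' _ => ?_
    have hadd : addScopes e S H ((Equiv.arrowProdEquivProdArrow (Fin d) _ _).symm
        (blockEquiv d κ (IndexPos d κ) f, (Equiv.arrowProdEquivProdArrow (Fin d) _ _).symm
          (U, blockEquiv d κ (Fin n) S'))) = H ∪ (blockList e (S ∘ f) S' U).toFinset := by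
      rw [toFinset_blockList]
      rfl
    rw [hadd]
    simp only [hterm]
    by_cases hc : LowMultiplicity U ∧ ∀ j,
            (blockScopes e (indexBlock (S ∘ f) j) (indexBlock S' j) (U j)).card = 2
    -- Low multiplicity of `U` becomes the fibre bound required by `sum_blocks_le`.
    · rw [if_pos hc, if_pos]
      refine ⟨fun u => ?_, fun j => hc.2 j⟩
      have h5 := card_filter_blockList_le hlast (S ∘ f) S' hc.1 u
      have h6 := hfib u
      have h7 : (((H ∪ (blockList e (S ∘ f) S' U).toFinset).filter fun s => last s = u).card : ℝ) ≤
          (H.filter fun s => last s = u).card +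
            ((blockList e (S ∘ f) S' U).toFinset.filter fun s => last s = u).card := by
        rw [Finset.filter_union]
        exact_mod_cast Finset.card_union_le _ _
      linarith
    · rw [if_neg hc]
      split_ifs <;> positivity
  calc _ ≤ Real.exp q / (q : ℝ) ^ q * (y ^ H.card *
        blockBound q n κ y (100 * Real.log n) h m ^ d) := by gcongr
    _ = _ := by ring

end Step

/-! ### The certificate as a sum of block monomials. -/

section Scopes

variable {n k κ d : ℕ}

/-- The scope `(I, K, u)`. -/
def scopeOf (hk : k = 2 * κ + 1) (I K : Fin κ → Fin n) (u : Fin n) : Fin k → Fin n := fun t =>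
  (Fin.snoc (Fin.append I K) u : Fin (κ + κ + 1) → Fin n) (Fin.cast (by omega) t)

/-- The last entry of a scope. -/
def lastEntry (hk : k = 2 * κ + 1) (s : Fin k → Fin n) : Fin n := s ⟨2 * κ, by omega⟩

theorem lastEntry_scopeOf (hk : k = 2 * κ + 1) (I K : Fin κ → Fin n) (u : Fin n) :
    lastEntry hk (scopeOf hk I K u) = u := by
  have : (Fin.cast (by omega) (⟨2 * κ, by omega⟩ : Fin k) : Fin (κ + κ + 1)) = Fin.last _ := by
    ext; simp; omega
  simp only [lastEntry, scopeOf, this, Fin.snoc_last]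

theorem scopeOf_injective (hk : k = 2 * κ + 1) (u : Fin n) :
    Function.Injective fun q : (Fin κ → Fin n) × (Fin κ → Fin n) => scopeOf hk q.1 q.2 u := by
  rintro ⟨I, K⟩ ⟨I', K'⟩ h
  have h' : Fin.append I K = Fin.append I' K' := by
    ext t
    have := congrFun h (Fin.cast (by omega) t.castSucc)
    simp only [scopeOf, Fin.cast_cast, Fin.cast_eq_self, Fin.snoc_castSucc] at this
    rw [this]
  refine Prod.ext ?_ ?_
  · funext t
    have := congrFun h' (Fin.castAdd κ t)
    rwa [Fin.append_left, Fin.append_left] at this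
  · funext t
    have := congrFun h' (Fin.natAdd κ t)
    rwa [Fin.append_right, Fin.append_right] at this

/-- For fixed `u` the scope determines its halves, so the removed squares are exactly the entries
whose two scopes coincide. -/
theorem squaredSlice_apply (hk : k = 2 * κ + 1) (Φ : XorInstance n k) (u : Fin n)
    (r c : (Fin κ → Fin n) × (Fin κ → Fin n)) :
    squaredSlice hk Φ u r c =
      if (blockScopes (scopeOf hk) r c u).card = 2 then
        xorTensor Φ (scopeOf hk r.1 c.1 u) * xorTensor Φ (scopeOf hk r.2 c.2 u) else 0 := by
  have h1 : (blockScopes (scopeOf hk) r c u).card = 2 ↔ ¬ ((r.1, c.1) = (r.2, c.2)) := by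
    rw [← (scopeOf_injective hk u).eq_iff]
    constructor
    · intro h heq
      simp only at heq
      rw [blockScopes, heq] at h
      simp at h
    · exact fun h => Finset.card_pair h
  simp only [squaredSlice, squaresPart, Matrix.sub_apply, Matrix.of_apply, h1, ite_not]
  split_ifs
  · simp
  · simp [Matrix.kroneckerMap_apply, xorSlice]
    rfl

open scoped Classical in
theorem slicePowerSum_apply (hk : k = 2 * κ + 1) (Φ : XorInstance n k)
    (R R' : IndexPos d κ → Fin n) :
    slicePowerSum hk d Φ R R' = ∑ U, blockMonomial (scopeOf hk) Φ R R' U := by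
  simp only [slicePowerSum, Matrix.of_apply]
  refine Finset.sum_congr rfl fun U _ => ?_
  simp only [blockMonomial, squaredSlice_apply]
  by_cases hU : LowMultiplicity U
  · by_cases hc : ∀ j, (blockScopes (scopeOf hk) (indexBlock R j) (indexBlock R' j) (U j)).card = 2
    · simp [hU, hc]
    · rw [if_pos hU, if_neg (fun h => hc h.2)]
      push Not at hc
      obtain ⟨j, hj⟩ := hc
      exact Finset.prod_eq_zero (Finset.mem_univ j) (if_neg hj)
  · simp [hU]

open scoped Classical in
/-- The random matrix with the sum of the block monomials for `e`, symmetrized and restricted to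
index tuples of low multiplicity, as its entries. -/
noncomputable def certificateOf (d : ℕ)
    (e : (Fin κ → Fin n) → (Fin κ → Fin n) → Fin n → (Fin k → Fin n))
    (Φ : XorInstance n k) : Matrix (IndexPos d κ → Fin n) (IndexPos d κ → Fin n) ℝ :=
  Matrix.of fun S S' => if LowMultiplicity S ∧ LowMultiplicity S' then
    ((Fintype.card (Equiv.Perm (IndexPos d κ)) : ℝ) ^ 2)⁻¹ *
      ∑ π : Equiv.Perm (IndexPos d κ), ∑ σ : Equiv.Perm (IndexPos d κ), ∑ U : Fin d → Fin n,
        blockMonomial e Φ (S ∘ π) (S' ∘ σ) U else 0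

theorem oddCertificate_eq (hk : k = 2 * κ + 1) (d : ℕ) (Φ : XorInstance n k) :
    oddCertificate hk d Φ = certificateOf d (scopeOf hk) Φ := by
  ext S S'
  simp only [oddCertificate, certificateOf, symmetrizeIndices, Matrix.of_apply, Matrix.smul_apply,
    Matrix.sum_apply, Matrix.submatrix_apply, slicePowerSum_apply, smul_eq_mul]

/-- Transposition only swaps the two halves inside each scope. This is why the counting is done for
a general `e`: it then covers `M` and `Mᵀ` alike. -/
theorem transpose_certificateOf (d : ℕ)
    (e : (Fin κ → Fin n) → (Fin κ → Fin n) → Fin n → (Fin k → Fin n)) (Φ : XorInstance n k) :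
    (certificateOf d e Φ).transpose = certificateOf d (fun I K u => e K I u) Φ := by
  classical
  ext S S'
  simp only [certificateOf, Matrix.of_apply, Matrix.transpose_apply]
  rw [Finset.sum_comm]
  exact if_congr and_comm rfl rfl

end Scopes

/-! ### Induction on the number of matrix factors. -/

section MomentBound

variable {n k κ d : ℕ}

/-- All mixed moments of the entries of the random matrix `Q` with a list `l` of tensor entries are
at most `C * y ^ #l`, provided that `l` has `N - 2 * d * t` terms and that every last entry occurs in
at most `m - 200 * t * log n` of its scopes. -/
def MomentBound {ι : Type*} (p : ℝ) (last : (Fin k → Fin n) → Fin n) (d N : ℕ) (m y : ℝ) (t : ℕ)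
    (C : ℝ) (Q : XorInstance n k → Matrix ι ι ℝ) : Prop :=
  ∀ l : List (Fin k → Fin n), l.length + 2 * d * t = N →
    (∀ u, ((l.toFinset.filter fun s => last s = u).card : ℝ) + t * (2 * (100 * Real.log n)) ≤ m) →
    ∀ S S₀, |∫ Φ, (l.map (xorTensor Φ)).prod * Q Φ S S₀ ∂randomXor n k p| ≤
      C * y ^ l.toFinset.card

/-- A nonzero mean forces at most `M` distinct scopes among `2 * M`, and `x ≥ 1` then allows `x ^
#scopes` to be replaced by `x ^ M`. -/
theorem momentBound_one {ι : Type*} [DecidableEq ι] {p : ℝ} (hp : p ∈ Set.Icc (0 : ℝ) 1)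
    (last : (Fin k → Fin n) → Fin n) (d M : ℕ) (m : ℝ) {x y : ℝ} (hx : 1 ≤ x) (hy : 0 ≤ y)
    (hxy : x * y = p) :
    MomentBound p last d (2 * M) m y 0 (x ^ M) fun _ => (1 : Matrix ι ι ℝ) := by
  intro l hl _ S S₀
  simp only [integral_mul_const]
  rw [abs_mul]
  have h1 : |(1 : Matrix ι ι ℝ) S S₀| ≤ 1 := by
    rw [Matrix.one_apply]; split_ifs <;> simp
  have h2 := abs_integral_prod_xorTensor_le hp l
  refine (mul_le_of_le_one_right (abs_nonneg _) h1).trans (h2.trans ?_)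
  split_ifs with hc
  · rw [← hxy, mul_pow]
    gcongr
    omega
  · positivity

/-- The factor gained in one step. -/
noncomputable def stepBound (d n κ : ℕ) (y lam h m : ℝ) : ℝ :=
  Real.exp (Fintype.card (IndexPos d κ)) /
    (Fintype.card (IndexPos d κ) : ℝ) ^ Fintype.card (IndexPos d κ) *
    blockBound (Fintype.card (IndexPos d κ)) n κ y lam h m ^ d

/-- Only the new left factor is expanded. Its monomials are appended to `l`, and the bound for `Q`
is applied to the longer list; quantifying over `l` thus handles the dependence between the factors.
The leftover weights are summed by `sum_step_le`. -/
theorem MomentBound.mul {p : ℝ} (hp : p ∈ Set.Icc (0 : ℝ) 1)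
    {e : (Fin κ → Fin n) → (Fin κ → Fin n) → Fin n → (Fin k → Fin n)}
    {last : (Fin k → Fin n) → Fin n} (hlast : ∀ I K u, last (e I K u) = u)
    (hinj : ∀ u, Function.Injective fun q : (Fin κ → Fin n) × (Fin κ → Fin n) => e q.1 q.2 u)
    {N t : ℕ} {m y C : ℝ} (hy : 0 ≤ y) (hm : 0 ≤ m) (hC : 0 ≤ C)
    {Q : XorInstance n k → Matrix (IndexPos d κ → Fin n) (IndexPos d κ → Fin n) ℝ}
    (hQ : MomentBound p last d N m y t C Q) :
    MomentBound p last d N m y (t + 1) (C * stepBound d n κ y (100 * Real.log n) N m)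
      fun Φ => certificateOf d e Φ * Q Φ := by
  classical
  intro l hl hfib S S₀
  have := isProbabilityMeasure_randomXor n k hp
  have hlog : 0 ≤ Real.log n := Real.log_natCast_nonneg n
  have hsb : 0 ≤ stepBound d n κ y (100 * Real.log n) N m := by
    unfold stepBound blockBound; positivity
  by_cases hS : LowMultiplicity S
  swap
  · simp only [Matrix.mul_apply, certificateOf, Matrix.of_apply, hS, false_and, if_false, zero_mul,
      Finset.sum_const_zero, mul_zero, integral_zero, abs_zero]
    positivity
  set Z : ℝ := (Fintype.card (Equiv.Perm (IndexPos d κ)) : ℝ) with hZ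
  have hexp : ∀ Φ : XorInstance n k, (l.map (xorTensor Φ)).prod * (certificateOf d e Φ * Q Φ) S S₀ =
      ∑ S' : IndexPos d κ → Fin n, ∑ π : Equiv.Perm (IndexPos d κ),
        ∑ σ : Equiv.Perm (IndexPos d κ), ∑ U : Fin d → Fin n,
          (if LowMultiplicity S' then (Z ^ 2)⁻¹ else 0) *
            ((l.map (xorTensor Φ)).prod * (blockMonomial e Φ (S ∘ π) (S' ∘ σ) U * Q Φ S' S₀)) := by
    intro Φ
    rw [Matrix.mul_apply, Finset.mul_sum]
    refine Finset.sum_congr rfl fun S' _ => ?_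
    simp only [certificateOf, Matrix.of_apply, hS, true_and, ← Finset.mul_sum, ← Finset.sum_mul]
    split_ifs
    · ring
    · simp
  have hint : ∀ g : XorInstance n k → ℝ, Integrable g (randomXor n k p) := fun g =>
    Integrable.of_finite
  have hterm : ∀ (S' : IndexPos d κ → Fin n) (π σ : Equiv.Perm (IndexPos d κ)) (U : Fin d → Fin n),
      |∫ Φ, (if LowMultiplicity S' then (Z ^ 2)⁻¹ else 0) * ((l.map (xorTensor Φ)).prod *
        (blockMonomial e Φ (S ∘ π) (S' ∘ σ) U * Q Φ S' S₀)) ∂randomXor n k p| ≤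
      (Z ^ 2)⁻¹ * C * (if LowMultiplicity U ∧ ∀ j,
            (blockScopes e (indexBlock (S ∘ π) j) (indexBlock (S' ∘ σ) j) (U j)).card = 2 then
          y ^ (l.toFinset ∪ (blockList e (S ∘ π) (S' ∘ σ) U).toFinset).card else 0) := by
    intro S' π σ U
    rw [integral_const_mul, abs_mul, mul_assoc]
    -- The restriction on `S'` can be dropped: the count needs low multiplicity of the row tuple `S`
    -- only.
    refine mul_le_mul ?_ ?_ (abs_nonneg _) (by positivity)
    · split_ifs
      · exact (abs_of_nonneg (by positivity)).le
      · simp only [abs_zero]; positivity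
    · by_cases hc : LowMultiplicity U ∧ ∀ j,
            (blockScopes e (indexBlock (S ∘ π) j) (indexBlock (S' ∘ σ) j) (U j)).card = 2
      · simp only [blockMonomial, hc]
        have h1 := hQ (l ++ blockList e (S ∘ π) (S' ∘ σ) U) (by
          rw [List.length_append, length_blockList, ← hl]; ring) (fun u => by
          have h2 := hfib u
          have h3 := card_filter_blockList_le hlast (S ∘ π) (S' ∘ σ) hc.1 u
          have h4 : (((l ++ blockList e (S ∘ π) (S' ∘ σ) U).toFinset.filter
              fun s => last s = u).card : ℝ) ≤ (l.toFinset.filter fun s => last s = u).card +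
                ((blockList e (S ∘ π) (S' ∘ σ) U).toFinset.filter fun s => last s = u).card := by
            rw [List.toFinset_append, Finset.filter_union]
            exact_mod_cast Finset.card_union_le _ _
          push_cast at h2
          linarith) S' S₀
        simp only [List.map_append, List.prod_append, prod_blockList, mul_assoc,
          List.toFinset_append] at h1
        simpa using h1
      · simp only [blockMonomial, if_neg hc, zero_mul, mul_zero, integral_zero, abs_zero, le_refl]
  have hcard : (l.toFinset.card : ℝ) + 2 * d ≤ N := by
    have h1 := l.toFinset_card_le
    have h2 : l.length + 2 * d ≤ N := by
      rw [← hl, mul_add, mul_one]; omega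
    exact_mod_cast (Nat.add_le_add_right h1 _).trans h2
  have hstep := sum_step_le hlast hinj hS hy (Nat.cast_nonneg N) hm (H := l.toFinset) hcard
    (fun u => by
      have h1 := hfib u
      have h2 : 0 ≤ (t : ℝ) * (2 * (100 * Real.log n)) := by positivity
      push_cast at h1
      linarith)
  simp only [hexp]
  rw [integral_finsetSum _ fun _ _ => hint _]
  calc _ ≤ ∑ S' : IndexPos d κ → Fin n, ∑ π : Equiv.Perm (IndexPos d κ),
        ∑ σ : Equiv.Perm (IndexPos d κ), ∑ U : Fin d → Fin n, (Z ^ 2)⁻¹ * C *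
          (if LowMultiplicity U ∧ ∀ j,
            (blockScopes e (indexBlock (S ∘ π) j) (indexBlock (S' ∘ σ) j) (U j)).card = 2 then
          y ^ (l.toFinset ∪ (blockList e (S ∘ π) (S' ∘ σ) U).toFinset).card else 0) := by
        refine (Finset.abs_sum_le_sum_abs _ _).trans (Finset.sum_le_sum fun S' _ => ?_)
        rw [integral_finsetSum _ fun _ _ => hint _]
        refine (Finset.abs_sum_le_sum_abs _ _).trans (Finset.sum_le_sum fun π _ => ?_)
        rw [integral_finsetSum _ fun _ _ => hint _]
        refine (Finset.abs_sum_le_sum_abs _ _).trans (Finset.sum_le_sum fun σ _ => ?_)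
        rw [integral_finsetSum _ fun _ _ => hint _]
        exact (Finset.abs_sum_le_sum_abs _ _).trans (Finset.sum_le_sum fun U _ => hterm S' π σ U)
    _ ≤ C * (y ^ l.toFinset.card * stepBound d n κ y (100 * Real.log n) N m) := by
        simp only [← Finset.mul_sum]
        rw [mul_comm _ C, mul_assoc]
        exact mul_le_mul_of_nonneg_left hstep hC
    _ = _ := by ring

/-- Moments of the powers of `M * Mᵀ`, where `M` is the certificate matrix. -/
theorem momentBound_pow (hk : k = 2 * κ + 1) {p : ℝ} (hp : p ∈ Set.Icc (0 : ℝ) 1) (d M : ℕ)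
    {m x y : ℝ} (hm : 0 ≤ m) (hx : 1 ≤ x) (hy : 0 ≤ y) (hxy : x * y = p) (r : ℕ) :
    MomentBound p (lastEntry hk) d (2 * M) m y (2 * r)
      (x ^ M * stepBound d n κ y (100 * Real.log n) (2 * M : ℕ) m ^ (2 * r))
      fun Φ : XorInstance n k => (oddCertificate hk d Φ * (oddCertificate hk d Φ).transpose) ^ r := by
  have hlog : 0 ≤ Real.log n := Real.log_natCast_nonneg n
  have hsb : 0 ≤ stepBound d n κ y (100 * Real.log n) (2 * M : ℕ) m := by
    unfold stepBound blockBound; positivity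
  induction r with
  | zero => simpa using momentBound_one hp (lastEntry hk) d M m hx hy hxy
  | succ r ih =>
    have h1 := ih.mul (e := fun I K u => scopeOf hk K I u) hp
      (fun I K u => lastEntry_scopeOf hk K I u)
      (fun u => (scopeOf_injective hk u).comp Prod.swap_injective) hy hm (by positivity)
    have h2 := h1.mul (e := scopeOf hk) hp (lastEntry_scopeOf hk) (scopeOf_injective hk) hy hm
      (by positivity)
    convert h2 using 1
    · ring
    · ring
    · funext Φ
      rw [pow_succ', oddCertificate_eq, transpose_certificateOf, mul_assoc]

theorem integral_trace_pow_le (hk : k = 2 * κ + 1) {p : ℝ} (hp : p ∈ Set.Icc (0 : ℝ) 1) (d r : ℕ)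
    {x y : ℝ} (hx : 1 ≤ x) (hy : 0 ≤ y) (hxy : x * y = p) :
    ∫ Φ : XorInstance n k,
        ((oddCertificate hk d Φ * (oddCertificate hk d Φ).transpose) ^ r).trace ∂randomXor n k p ≤
      (n : ℝ) ^ Fintype.card (IndexPos d κ) * (x ^ (2 * d * r) *
        stepBound d n κ y (100 * Real.log n) (4 * d * r : ℕ)
          ((2 * r : ℕ) * (2 * (100 * Real.log n))) ^ (2 * r)) := by
  have := isProbabilityMeasure_randomXor n k hp
  have hlog : 0 ≤ Real.log n := Real.log_natCast_nonneg n
  simp only [Matrix.trace, Matrix.diag_apply]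
  rw [integral_finsetSum _ fun _ _ => Integrable.of_finite]
  have h := momentBound_pow (n := n) hk hp d (2 * d * r)
    (m := (2 * r : ℕ) * (2 * (100 * Real.log n))) (by positivity) hx hy hxy r
  have h4 : 2 * (2 * d * r) = 4 * d * r := by ring
  rw [h4] at h
  calc _ ≤ ∑ _S : IndexPos d κ → Fin n, (x ^ (2 * d * r) *
        stepBound d n κ y (100 * Real.log n) (4 * d * r : ℕ)
          ((2 * r : ℕ) * (2 * (100 * Real.log n))) ^ (2 * r)) := by
        refine Finset.sum_le_sum fun S _ => (le_abs_self _).trans ?_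
        -- The empty list: the length and fibre budgets are exactly those of `2 * r` factors.
        simpa using h [] (by simp; ring) (fun u => by simp) S S
    _ = _ := by
      simp only [Finset.sum_const, Finset.card_univ, nsmul_eq_mul]
      rw [Fintype.card_fun]
      push_cast
      simp

end MomentBound

/-! ### Operator norm against traces of powers. -/

section Norm

variable {ι : Type*} [Fintype ι] [DecidableEq ι]

/-- For symmetric `C` the trace is the squared Frobenius norm, which dominates by Cauchy–Schwarz. -/
theorem euclideanOpNorm_sq_le_trace (C : Matrix ι ι ℝ) (hC : C.transpose = C) :
    euclideanOpNorm C ^ 2 ≤ (C * C).trace := by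
  have htr : (C * C).trace = ∑ i, ∑ j, C i j ^ 2 := by
    simp only [Matrix.trace, Matrix.diag_apply, Matrix.mul_apply]
    refine Finset.sum_congr rfl fun i _ => Finset.sum_congr rfl fun j _ => ?_
    rw [pow_two]
    congr 1
    exact congrFun (congrFun hC i) j
  have h0 : 0 ≤ (C * C).trace := by rw [htr]; positivity
  rw [← Real.sq_sqrt h0]
  refine pow_le_pow_left₀ (norm_nonneg _) ?_ 2
  refine ContinuousLinearMap.opNorm_le_bound _ (Real.sqrt_nonneg _) fun v => ?_
  rw [EuclideanSpace.norm_eq, EuclideanSpace.norm_eq, ← Real.sqrt_mul h0]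
  refine Real.sqrt_le_sqrt ?_
  rw [htr, Finset.sum_mul]
  refine Finset.sum_le_sum fun i _ => ?_
  simp only [Matrix.ofLp_toEuclideanCLM, Real.norm_eq_abs, sq_abs, Matrix.mulVec, dotProduct]
  exact Finset.sum_mul_sq_le_sq_mul_sq _ _ _

-- The C⋆-identity gives `‖M * Mᵀ‖ = ‖M‖ ^ 2`, and repeated squaring of this self-adjoint matrix
-- squares its norm each time; hence the powers of two.
open scoped Matrix.Norms.L2Operator in
theorem euclideanOpNorm_pow_le_trace (M : Matrix ι ι ℝ) (s : ℕ) :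
    euclideanOpNorm M ^ (4 * 2 ^ s) ≤ ((M * M.transpose) ^ (2 * 2 ^ s)).trace := by
  have hsa : IsSelfAdjoint (M * star M) := IsSelfAdjoint.mul_star_self M
  have hstar : star M = M.transpose := by
    rw [Matrix.star_eq_conjTranspose, Matrix.conjTranspose_eq_transpose_of_trivial]
  have h1 : euclideanOpNorm ((M * star M) ^ 2 ^ s) = euclideanOpNorm M ^ (2 * 2 ^ s) := by
    have h2 := hsa.norm_pow_two_pow s
    rw [CStarRing.norm_self_mul_star, ← pow_two, ← pow_mul] at h2
    exact h2
  have h3 := euclideanOpNorm_sq_le_trace ((M * star M) ^ 2 ^ s) (by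
    have := (hsa.pow (2 ^ s)).star_eq
    rwa [Matrix.star_eq_conjTranspose, Matrix.conjTranspose_eq_transpose_of_trivial] at this)
  rw [h1, ← pow_mul, ← pow_two, ← pow_mul, hstar] at h3
  rwa [mul_comm (2 ^ s) 2, show 2 * 2 ^ s * 2 = 4 * 2 ^ s by ring] at h3

end Norm

/-! ### Choice of parameters and Markov's inequality. -/

section Bounds

/-- This `y` makes `n ^ (2κ + 1) * y ^ 2` equal to `d / d ^ (2κ)`. The terms with old scopes match
it up to `lam`, `h₀`, `m`, since `d ≤ n` gives `y * n ^ κ ≤ 1 / d ^ κ`. The averaging factor is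
`(exp (2κ) / q ^ (2κ)) ^ d` and cancels the `q ^ (2κ)` of each block. -/
theorem stepBound_le {d n κ : ℕ} (hd : 1 ≤ d) (hdn : d ≤ n) {lam h₀ m : ℝ} (hlam : 0 ≤ lam)
    (hh : 0 ≤ h₀) (hm : 0 ≤ m) :
    stepBound d n κ (√d / (√n * n ^ κ * d ^ κ)) lam (d * h₀) m ≤
      (Real.exp (2 * κ) * (1 + 2 * h₀ * lam ^ κ + h₀ * m * lam ^ (2 * κ)) *
        (d / d ^ (2 * κ))) ^ d := by
  have hd0 : (0 : ℝ) < d := by exact_mod_cast hd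
  have hn0 : (0 : ℝ) < n := by exact_mod_cast hd.trans hdn
  have hsn : 0 < √(n : ℝ) := Real.sqrt_pos.2 hn0
  set y : ℝ := √d / (√n * n ^ κ * d ^ κ) with hy
  have hy0 : 0 ≤ y := by positivity
  set q : ℝ := (d : ℝ) * (2 * κ) with hq
  have hcard : Fintype.card (IndexPos d κ) = d * (2 * κ) := by simp [IndexPos]
  have hq0 : 0 ≤ q := by positivity
  have hqd : (d : ℝ) ^ κ ≤ q ^ κ := by
    -- For `κ = 0` there are no positions and `q = 0`, but both powers are `1`.
    rcases Nat.eq_zero_or_pos κ with rfl | hκ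
    · simp
    · have : (1 : ℝ) ≤ κ := by exact_mod_cast hκ
      gcongr
      rw [hq]; nlinarith
  have hqd2 : (d : ℝ) ^ (2 * κ) ≤ q ^ (2 * κ) := by
    rw [mul_comm 2 κ, pow_mul, pow_mul]; gcongr
  have hdκ : (0 : ℝ) < (d : ℝ) ^ κ := by positivity
  have hqκ : 0 < q ^ (2 * κ) := lt_of_lt_of_le (by positivity) hqd2
  have hy2 : (n : ℝ) ^ (2 * κ + 1) * y ^ 2 = d / d ^ (2 * κ) := by
    rw [hy, div_pow, mul_pow, mul_pow, Real.sq_sqrt hd0.le, Real.sq_sqrt hn0.le]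
    field_simp
    ring
  have hyn : y * n ^ κ ≤ 1 / d ^ κ := by
    have : √(d : ℝ) ≤ √n := Real.sqrt_le_sqrt (by exact_mod_cast hdn)
    rw [hy]
    calc _ = √(d : ℝ) / √n * (1 / d ^ κ) := by field_simp
      _ ≤ 1 * (1 / d ^ κ) := by gcongr; exact (div_le_one hsn).2 this
      _ = _ := one_mul _
  have hbb : blockBound (Fintype.card (IndexPos d κ)) n κ y lam (d * h₀) m ≤
      q ^ (2 * κ) * ((1 + 2 * h₀ * lam ^ κ + h₀ * m * lam ^ (2 * κ)) * (d / d ^ (2 * κ))) := by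
    have hc : ((Fintype.card (IndexPos d κ) : ℕ) : ℝ) = q := by rw [hcard, hq]; push_cast; ring
    rw [blockBound, hc]
    have t2 : 2 * y * (d * h₀) * q ^ κ * lam ^ κ * (n : ℝ) ^ κ ≤
        q ^ (2 * κ) * (2 * h₀ * lam ^ κ * (d / d ^ (2 * κ))) := by
      calc _ = (y * n ^ κ) * (2 * (d * h₀) * q ^ κ * lam ^ κ) := by ring
        _ ≤ (1 / d ^ κ) * (2 * (d * h₀) * q ^ κ * lam ^ κ) := by gcongr
        _ = (1 / d ^ (2 * κ)) * (2 * (d * h₀) * (d ^ κ * q ^ κ) * lam ^ κ) := by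
          rw [two_mul κ, pow_add]; field_simp
        _ ≤ (1 / d ^ (2 * κ)) * (2 * (d * h₀) * (q ^ κ * q ^ κ) * lam ^ κ) := by gcongr
        _ = _ := by ring
    have t3 : d * h₀ * m * lam ^ (2 * κ) ≤
        q ^ (2 * κ) * (h₀ * m * lam ^ (2 * κ) * (d / d ^ (2 * κ))) := by
      calc _ = d ^ (2 * κ) * (h₀ * m * lam ^ (2 * κ) * (d / d ^ (2 * κ))) := by field_simp
        _ ≤ _ := by gcongr
    have t1 : q ^ (2 * κ) * (n : ℝ) ^ (2 * κ + 1) * y ^ 2 = q ^ (2 * κ) * (d / d ^ (2 * κ)) := by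
      rw [mul_assoc, hy2]
    rw [t1]
    linarith
  have hbb0 : 0 ≤ blockBound (Fintype.card (IndexPos d κ)) n κ y lam (d * h₀) m := by
    unfold blockBound; positivity
  have hE : Real.exp (Fintype.card (IndexPos d κ)) /
      (Fintype.card (IndexPos d κ) : ℝ) ^ Fintype.card (IndexPos d κ) =
      (Real.exp (2 * κ) / q ^ (2 * κ)) ^ d := by
    rw [div_pow, ← Real.exp_nat_mul, ← pow_mul, hcard, hq]
    push_cast
    rw [mul_comm (2 * κ) d]
  rw [stepBound, hE, ← mul_pow]
  refine pow_le_pow_left₀ (by positivity) ?_ d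
  calc _ ≤ Real.exp (2 * κ) / q ^ (2 * κ) * (q ^ (2 * κ) *
        ((1 + 2 * h₀ * lam ^ κ + h₀ * m * lam ^ (2 * κ)) * (d / d ^ (2 * κ)))) := by gcongr
    _ = _ := by field_simp

/-- The constant in the norm bound. -/
noncomputable def normConst (κ : ℕ) : ℝ :=
  Real.exp (2 * κ) * (1 + 32 * 100 ^ κ + 25600 * 100 ^ (2 * κ))

/-- Inserting `T ≤ 8 * L` gives the coefficients `32 = 2 * 2 * 8` and `25600 = 2 * 8 * 8 * 200`; the
last term has the top degree `2 * κ + 3`. -/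
theorem logFactor_le (κ : ℕ) {L T : ℝ} (hL : 1 ≤ L) (hT0 : 0 ≤ T) (hT : T ≤ 8 * L) :
    Real.exp (2 * κ) * (1 + 2 * (2 * T) * (100 * L) ^ κ +
      2 * T * (T * (2 * (100 * L))) * (100 * L) ^ (2 * κ)) ≤ normConst κ * L ^ (2 * κ + 3) := by
  have hL0 : 0 ≤ L := by linarith
  rw [normConst, mul_assoc (Real.exp _)]
  refine mul_le_mul_of_nonneg_left ?_ (Real.exp_nonneg _)
  have h1 : 1 ≤ L ^ (2 * κ + 3) := one_le_pow₀ hL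
  have h2 : L * L ^ κ ≤ L ^ (2 * κ + 3) := by
    rw [← pow_succ']; exact pow_le_pow_right₀ hL (by omega)
  have h3 : 2 * (2 * T) * (100 * L) ^ κ ≤ 32 * 100 ^ κ * L ^ (2 * κ + 3) := by
    calc _ ≤ 2 * (2 * (8 * L)) * (100 * L) ^ κ := by gcongr
      _ = 32 * 100 ^ κ * (L * L ^ κ) := by rw [mul_pow]; ring
      _ ≤ _ := by gcongr
  have h4 : 2 * T * (T * (2 * (100 * L))) * (100 * L) ^ (2 * κ) ≤
      25600 * 100 ^ (2 * κ) * L ^ (2 * κ + 3) := by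
    calc _ ≤ 2 * (8 * L) * (8 * L * (2 * (100 * L))) * (100 * L) ^ (2 * κ) := by gcongr
      _ = _ := by rw [mul_pow, pow_add]; ring
  linarith

theorem one_sub_le_prob_norm_le {k κ n d A : ℕ} (hk : k = 2 * κ + 1) {p : ℝ}
    (hp : p ∈ Set.Icc (0 : ℝ) 1) (hd : 1 ≤ d) (hdn : d ≤ n)
    (hx : 1 ≤ p * (√n * n ^ κ * d ^ κ) / √d) (hL : Real.exp (κ + A) ≤ Real.log n) :
    1 - 1 / (n : ℝ) ^ A ≤ (randomXor n k p).real
      {Φ | euclideanOpNorm (oddCertificate hk d Φ) ^ (1 / (d : ℝ)) ≤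
        normConst κ * Real.log n ^ (2 * κ + 4) * (p * (√n * n ^ κ) / (d ^ κ / √d))} := by
  have := isProbabilityMeasure_randomXor n k hp
  have hd0 : (0 : ℝ) < d := by exact_mod_cast hd
  have hn0 : (0 : ℝ) < n := by exact_mod_cast hd.trans hdn
  have hsn : 0 < √(n : ℝ) := Real.sqrt_pos.2 hn0
  have hsd : 0 < √(d : ℝ) := Real.sqrt_pos.2 hd0
  set L := Real.log n with hLdef
  have hL1 : 1 ≤ L := (Real.one_le_exp (by positivity)).trans hL
  -- Rounding `log n` to a power of two makes `T` an admissible trace exponent with `4 * L ≤ T ≤ 8 *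
  -- L`.
  obtain ⟨s, hs1, hs2⟩ := exists_nat_pow_near hL1 one_lt_two
  set r : ℕ := 2 * 2 ^ (s + 1) with hr
  set T : ℕ := 2 * r with hT
  have hT1 : 4 * L ≤ T := by
    rw [hT, hr]; push_cast; linarith
  have hT2 : (T : ℝ) ≤ 8 * L := by
    rw [hT, hr]; push_cast; rw [pow_succ]; linarith
  set x : ℝ := p * (√n * n ^ κ * d ^ κ) / √d with hxdef
  set y : ℝ := √d / (√n * n ^ κ * d ^ κ) with hydef
  have hxy : x * y = p := by rw [hxdef, hydef]; field_simp
  set g : ℝ := p * (√n * n ^ κ) / (d ^ κ / √d) with hg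
  have hgx : g = x * (d / d ^ (2 * κ)) := by
    rw [hg, hxdef]
    have : (d : ℝ) = √d * √d := (Real.mul_self_sqrt hd0.le).symm
    rw [two_mul κ, pow_add]
    field_simp
    rw [pow_two, ← this]
  have hg0 : 0 < g := by rw [hgx]; positivity
  set G : ℝ := Real.exp (2 * κ) * (1 + 2 * (2 * T) * (100 * L) ^ κ +
      2 * T * (T * (2 * (100 * L))) * (100 * L) ^ (2 * κ)) with hG
  have hGle : G ≤ normConst κ * L ^ (2 * κ + 3) := logFactor_le κ hL1 (by positivity) hT2
  have hG0 : 0 < G := by positivity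
  set R : ℝ := normConst κ * L ^ (2 * κ + 4) * g with hR
  have hRG : g * G * L ≤ R := by
    calc _ = G * (g * L) := by ring
      _ ≤ normConst κ * L ^ (2 * κ + 3) * (g * L) := by gcongr
      _ = R := by rw [hR]; ring
  have hR0 : 0 < R := lt_of_lt_of_le (by positivity) hRG
  have hint : ∫ Φ : XorInstance n k,
      ((oddCertificate hk d Φ * (oddCertificate hk d Φ).transpose) ^ r).trace ∂randomXor n k p ≤
        (n : ℝ) ^ (d * (2 * κ)) * (g * G) ^ (d * T) := by
    have h1 := integral_trace_pow_le (n := n) hk hp d r hx (y := y) (by positivity) hxy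
    have hcard : Fintype.card (IndexPos d κ) = d * (2 * κ) := by simp [IndexPos]
    rw [hcard] at h1
    refine h1.trans (mul_le_mul_of_nonneg_left ?_ (by positivity))
    have h2 := stepBound_le (κ := κ) hd hdn (lam := 100 * L) (h₀ := 2 * T)
      (m := T * (2 * (100 * L))) (by positivity) (by positivity) (by positivity)
    rw [← hydef, ← hG] at h2
    have h3 : ((4 * d * r : ℕ) : ℝ) = d * (2 * T) := by rw [hT]; push_cast; ring
    rw [h3, ← hT]
    have h4 : 0 ≤ stepBound d n κ y (100 * L) (d * (2 * T)) (T * (2 * (100 * L))) := by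
      unfold stepBound blockBound; positivity
    calc _ ≤ x ^ (2 * d * r) * ((G * (d / d ^ (2 * κ))) ^ d) ^ T := by gcongr
      _ = _ := by
        have h5 : 2 * d * r = d * T := by rw [hT]; ring
        rw [← pow_mul, h5, ← mul_pow, hgx]
        ring
  -- The one logarithm in `R` beyond `logFactor_le` pays for both the dimension and the failure
  -- probability: `log L ≥ κ + A` and `T ≥ 4 * log n`.
  have hnL : (n : ℝ) ^ A * (n : ℝ) ^ (d * (2 * κ)) ≤ L ^ (d * T) := by
    have h1 : Real.exp (κ + A) ^ (d * T) ≤ L ^ (d * T) := by gcongr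
    refine le_trans ?_ h1
    rw [← pow_add, ← Real.exp_nat_mul]
    nth_rewrite 1 [← Real.exp_log hn0]
    rw [← Real.exp_nat_mul, Real.exp_le_exp, ← hLdef]
    push_cast
    have hd1 : (1 : ℝ) ≤ d := by exact_mod_cast hd
    calc ((A : ℝ) + d * (2 * κ)) * L ≤ (d * A + d * (2 * κ)) * L := by
          have hA : (A : ℝ) ≤ d * A := le_mul_of_one_le_left (by positivity) hd1
          gcongr
      _ ≤ d * (κ + A) * (4 * L) := by
          have h2 : 0 ≤ (d : ℝ) * κ * L := by positivity
          have h3 : 0 ≤ (d : ℝ) * A * L := by positivity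
          linarith
      _ ≤ d * (κ + A) * T := by gcongr
      _ = _ := by ring
  set E := {Φ : XorInstance n k | euclideanOpNorm (oddCertificate hk d Φ) ^ (1 / (d : ℝ)) ≤ R}
    with hE
  have hmeas : MeasurableSet E := (Set.toFinite E).measurableSet
  have hsub : Eᶜ ⊆ {Φ : XorInstance n k | R ^ (d * T) ≤
      ((oddCertificate hk d Φ * (oddCertificate hk d Φ).transpose) ^ r).trace} := by
    intro Φ hΦ
    simp only [hE, Set.mem_compl_iff, Set.mem_ofPred_eq, not_le] at hΦ ⊢
    have hnn : 0 ≤ euclideanOpNorm (oddCertificate hk d Φ) := norm_nonneg _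
    have h1 : R ^ d ≤ euclideanOpNorm (oddCertificate hk d Φ) := by
      have h2 := pow_le_pow_left₀ hR0.le hΦ.le d
      rwa [one_div, Real.rpow_inv_natCast_pow hnn (by omega)] at h2
    calc R ^ (d * T) = (R ^ d) ^ T := by rw [pow_mul]
      _ ≤ euclideanOpNorm (oddCertificate hk d Φ) ^ T := by gcongr
      _ ≤ _ := by
        have h3 := euclideanOpNorm_pow_le_trace (oddCertificate hk d Φ) (s + 1)
        rwa [show 4 * 2 ^ (s + 1) = T by rw [hT, hr]; ring, ← hr] at h3
  have hmarkov := mul_meas_ge_le_integral_of_nonneg (μ := randomXor n k p)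
    (f := fun Φ => ((oddCertificate hk d Φ * (oddCertificate hk d Φ).transpose) ^ r).trace)
    (ae_of_all _ fun Φ => by
      have h3 := euclideanOpNorm_pow_le_trace (oddCertificate hk d Φ) (s + 1)
      have hnn : 0 ≤ euclideanOpNorm (oddCertificate hk d Φ) := norm_nonneg _
      exact le_trans (by positivity) h3) Integrable.of_finite (R ^ (d * T))
  have hmono : (randomXor n k p).real Eᶜ ≤ (randomXor n k p).real {Φ : XorInstance n k |
      R ^ (d * T) ≤
        ((oddCertificate hk d Φ * (oddCertificate hk d Φ).transpose) ^ r).trace} :=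
    measureReal_mono hsub
  have hfin : (randomXor n k p).real Eᶜ ≤ 1 / (n : ℝ) ^ A := by
    rw [le_div_iff₀ (by positivity)]
    refine le_of_mul_le_mul_left ?_ (pow_pos hR0 (d * T))
    calc R ^ (d * T) * ((randomXor n k p).real Eᶜ * (n : ℝ) ^ A)
        ≤ (n : ℝ) ^ A * ((n : ℝ) ^ (d * (2 * κ)) * (g * G) ^ (d * T)) := by
          rw [← mul_assoc, mul_comm _ ((n : ℝ) ^ A)]
          refine mul_le_mul_of_nonneg_left ?_ (by positivity)
          exact (mul_le_mul_of_nonneg_left hmono (by positivity)).trans (hmarkov.trans hint)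
      _ ≤ L ^ (d * T) * (g * G) ^ (d * T) := by rw [← mul_assoc]; gcongr
      _ = (g * G * L) ^ (d * T) := by rw [← mul_pow]; ring
      _ ≤ R ^ (d * T) * 1 := by rw [mul_one]; gcongr
  have hcompl := probReal_compl_eq_one_sub (μ := randomXor n k p) hmeas
  linarith

end Bounds

/-! ### The asymptotic statement. -/

theorem mainTheorem8 (k κ : ℕ) (hk : k = 2 * κ + 1) :
    ∃ (c : ℝ) (a : ℕ), 0 < c ∧
      ∀ (d : ℕ → ℕ) (p : ℕ → ℝ),
        (∀ n, p n ∈ Set.Icc (0 : ℝ) 1) →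
        Tendsto (fun n : ℕ => (d n : ℝ) * Real.log n / n) atTop (𝓝 0) →
        (∀ᶠ n : ℕ in atTop,
          1 < (d n : ℝ) ^ (((k : ℝ) - 2) / 2) * (n : ℝ) ^ ((k : ℝ) / 2) * p n) →
        ∀ A : ℕ, ∀ᶠ n : ℕ in atTop,
          1 - 1 / (n : ℝ) ^ A ≤
            (randomXor n k (p n)).real
              {Φ | euclideanOpNorm (oddCertificate hk (d n) Φ) ^ (1 / (d n : ℝ)) ≤
                c * Real.log n ^ a *
                  (p n * (n : ℝ) ^ ((k : ℝ) / 2) / (d n : ℝ) ^ (((k : ℝ) - 2) / 2))} := by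
  refine ⟨normConst κ, 2 * κ + 4, by unfold normConst; positivity, ?_⟩
  intro d p hp hd hx A
  have hlog : ∀ᶠ n : ℕ in atTop, Real.exp (κ + A) ≤ Real.log n :=
    (Real.tendsto_log_atTop.comp tendsto_natCast_atTop_atTop).eventually_ge_atTop _
  filter_upwards [hlog, hd.eventually_lt_const one_pos, hx, eventually_gt_atTop 0] with n hL hdn hx hn
  have hn0 : (0 : ℝ) < n := by exact_mod_cast hn
  have hL1 : 1 ≤ Real.log n := (Real.one_le_exp (by positivity)).trans hL
  have hexp : ((k : ℝ) - 2) / 2 = κ - 1 / 2 := by rw [hk]; push_cast; ring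
  have hd1 : 1 ≤ d n := by
    -- As `k` is odd, the exponent of `d` is nonzero, so `d = 0` would make the density product `0`.
    by_contra! h0
    have hne : ((k : ℝ) - 2) / 2 ≠ 0 := by
      intro h
      have h1 : (k : ℝ) = 2 := by linarith
      have h2 : k = 2 := by exact_mod_cast h1
      omega
    rw [Nat.lt_one_iff.1 h0, Nat.cast_zero, Real.zero_rpow hne, zero_mul, zero_mul] at hx
    exact absurd hx (by norm_num)
  have hd0 : (0 : ℝ) < d n := by exact_mod_cast hd1
  have hdn' : d n ≤ n := by
    rw [div_lt_one hn0] at hdn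
    have : (d n : ℝ) ≤ n := by nlinarith
    exact_mod_cast this
  have hnk : (n : ℝ) ^ ((k : ℝ) / 2) = √n * n ^ κ := by
    rw [show (k : ℝ) / 2 = 1 / 2 + κ by rw [hk]; push_cast; ring, Real.rpow_add hn0,
      Real.rpow_natCast, Real.sqrt_eq_rpow]
  have hdk : (d n : ℝ) ^ (((k : ℝ) - 2) / 2) = d n ^ κ / √(d n) := by
    rw [hexp, Real.rpow_sub hd0, Real.rpow_natCast, Real.sqrt_eq_rpow]
  rw [hnk, hdk]
  rw [hnk, hdk] at hx
  refine one_sub_le_prob_norm_le hk (hp n) hd1 hdn' (hx.le.trans (le_of_eq ?_)) hL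
  ring
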